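/- Let $(X^{2n},\omega=d\lambda)$ be an exact symplectic manifold with corners (for example a Liouville sector). An \emph{exact Lagrangian} in $X$ is the image of a smooth proper embedding $i\colon M^n\to X$ of an $n$-manifold without boundary, with image in the interior of $X$, such that $i^*\omega=0$ and $i^*\lambda$ is an exact one-form. An \emph{exact Lagrangian isotopy} is a smooth family $(i_t\colon M\to X)_{t\in[0,1]}$ of such embeddings for which the map $[0,1]\times M\to X$, $(t,m)\mapsto i_t(m)$, is proper; it joins $i_0(M)$ to $i_1(M)$. A (two-component) \emph{Lagrangian link} is a disjoint union of two exact Lagrangians, and an \emph{isotopy of links} is a pair of exact Lagrangian isotopies of the components whose images are disjoint at every time $t\in[0,1]$. Let $T^*D^1=[-1,1]\times\mathbb R$ with coordinates $(q,p)$ and one-form $p\,dq$, let $T^*_0D^1=\{q=0\}$, and equip $X\times T^*D^1$ with the one-form $\lambda+p\,dq$ and its exterior derivative. Let $L\sqcup K$ and $L'\sqcup K'$ be Lagrangian links in $X$ that are component-wise isotopic: there are an exact Lagrangian isotopy $(i_t)$ in $X$ from $L$ to $L'$ and an exact Lagrangian isotopy $(j_t)$ in $X$ from $K$ to $K'$ (which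 may intersect each other). Then the stabilized links $$(L\times T^*_0D^1)\sqcup(K\times T^*_0D^1)\quad\text{and}\quad(L'\times T^*_0D^1)\sqcup(K'\times T^*_0D^1)$$ are isotopic as Lagrangian links in $X\times T^*D^1$. Moreover, the link isotopy $(I_t,J_t)$ can be chosen so that strong exactness is preserved: for every $t\in[0,1]$ and every one-form $\mu$ on $X$, if $i_t^*\mu=0$ then $I_t^*(\mu+p\,dq)=0$, and if $j_t^*\mu=0$ then $J_t^*(\mu+p\,dq)=0$. -/

import Mathlib

open Set
open scoped Manifold ContDiff

noncomputable section

section Forms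

variable {E : Type*} [NormedAddCommGroup E] [NormedSpace ℝ E]
  {H : Type*} [TopologicalSpace H] (I : ModelWithCorners ℝ E H)
  (X : Type*) [TopologicalSpace X] [ChartedSpace H X]

/-- A (not necessarily smooth) differential one-form on the manifold with corners `X`. -/
abbrev OneForm : Type _ := ∀ x : X, TangentSpace I x →L[ℝ] ℝ

variable {X}

/-- Smoothness of a one-form, as a section of the cotangent bundle. -/
def OneForm.IsSmooth [IsManifold I ∞ X] (θ : OneForm I X) : Prop :=
  ContMDiff I (I.prod 𝓘(ℝ, E →L[ℝ] ℝ)) ∞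
    (fun x : X => Bundle.TotalSpace.mk' (E →L[ℝ] ℝ)
      (E := fun x : X => TangentSpace I x →L[ℝ] Bundle.Trivial X ℝ x) x (θ x))

/-- The expression of the one-form `θ` in the preferred chart at `x`, i.e. its pullback to the
model vector space under the inverse of that chart. -/
def OneForm.inChart (θ : OneForm I X) (x : X) (y : E) : E →L[ℝ] ℝ :=
  (θ ((extChartAt I x).symm y)).comp
    (mfderivWithin 𝓘(ℝ, E) I (extChartAt I x).symm (range I) y)

/-- The exterior derivative `dθ` at `x`, evaluated on two tangent vectors: in the preferred chart
at `x` (whose differential at `x` is the identification of the tangent space at `x` with `E`),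
`dθ (u, v) = D_u θ (v) - D_v θ (u)`. -/
def OneForm.d (θ : OneForm I X) (x : X) (u v : TangentSpace I x) : ℝ :=
  (fderivWithin ℝ (θ.inChart I x) (range I) (extChartAt I x x) : E →L[ℝ] E →L[ℝ] ℝ) u v -
    (fderivWithin ℝ (θ.inChart I x) (range I) (extChartAt I x x) : E →L[ℝ] E →L[ℝ] ℝ) v u

/-- `(X, dθ)` is an exact symplectic manifold with corners: the one-form `θ` is smooth and
the two-form `dθ` is nondegenerate at every point. -/
structure IsExactSymplectic [IsManifold I ∞ X] (θ : OneForm I X) : Prop where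
  smooth : θ.IsSmooth I
  nondegenerate : ∀ (x : X) (u : TangentSpace I x), (∀ v, θ.d I x u v = 0) → u = 0

end Forms

section Lagrangians

variable {E : Type*} [NormedAddCommGroup E] [NormedSpace ℝ E]
  {H : Type*} [TopologicalSpace H] (I : ModelWithCorners ℝ E H)
  {X : Type*} [TopologicalSpace X] [ChartedSpace H X]
  {F : Type*} [NormedAddCommGroup F] [NormedSpace ℝ F]
  {G : Type*} [TopologicalSpace G] (J : ModelWithCorners ℝ F G)
  {M : Type*} [TopologicalSpace M] [ChartedSpace G M]
  {N : Type*} [TopologicalSpace N] [ChartedSpace G N]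

/-- The pullback `f^* θ`, at the point `m`. -/
def OneForm.pullback (θ : OneForm I X) (f : M → X) : OneForm J M :=
  fun m => (θ (f m)).comp (mfderiv J I f m)

/-- `f : M → X` is a proper embedding into the interior of `X` whose image is an
exact Lagrangian submanifold of `(X, dθ)`. -/
structure IsExactLagrangianEmbedding (θ : OneForm I X) (f : M → X) : Prop where
  smooth : ContMDiff J I ∞ f
  injective : Function.Injective f
  injective_mfderiv : ∀ m, Function.Injective (mfderiv J I f m)
  proper : IsProperMap f
  interior : ∀ m, f m ∈ I.interior X
  half_dim : 2 * Module.finrank ℝ F = Module.finrank ℝ E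
  isotropic : ∀ (m : M) (u v : TangentSpace J m),
    θ.d I (f m) (mfderiv J I f m u) (mfderiv J I f m v) = 0
  exact : ∃ g : M → ℝ, ContMDiff J 𝓘(ℝ, ℝ) ∞ g ∧
    ∀ (m : M) (u : TangentSpace J m), θ.pullback I J f m u = mfderiv J 𝓘(ℝ, ℝ) g m u

/-- `φ t`, for `t ∈ [0, 1]`, is an isotopy of properly embedded exact Lagrangians: it is smooth
in both variables, it is proper as a family, and every stage is a proper exact Lagrangian
embedding. Values at times outside `[0, 1]` are irrelevant. -/
structure IsExactLagrangianIsotopy (θ : OneForm I X) (φ : ℝ → M → X) : Prop where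
  smooth : ContMDiffOn (𝓘(ℝ, ℝ).prod J) I ∞ (fun p : ℝ × M => φ p.1 p.2)
    (Icc (0 : ℝ) 1 ×ˢ univ)
  proper : IsProperMap (fun p : Icc (0 : ℝ) 1 × M => φ p.1 p.2)
  embedding : ∀ t ∈ Icc (0 : ℝ) 1, IsExactLagrangianEmbedding I J θ (φ t)

/-- An isotopy of two-component Lagrangian links: the two components move by exact Lagrangian
isotopies and stay disjoint from each other at all times. -/
structure IsExactLagrangianLinkIsotopy (θ : OneForm I X) (φ : ℝ → M → X) (ψ : ℝ → N → X) :
    Prop where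
  first : IsExactLagrangianIsotopy I J θ φ
  second : IsExactLagrangianIsotopy I J θ ψ
  disjoint : ∀ t ∈ Icc (0 : ℝ) 1, Disjoint (range (φ t)) (range (ψ t))

end Lagrangians

section Stabilization

instance fact_neg_one_lt_one : Fact ((-1 : ℝ) < 1) := ⟨by norm_num⟩

/-- The cotangent bundle `T^*D^1` of `D^1 = [-1, 1]`, with coordinates `(q, p)`. -/
abbrev CotangentDisk : Type := Icc (-1 : ℝ) 1 × ℝ

/-- The model with corners of `T^*D^1`. -/
abbrev cotangentDiskModel :
    ModelWithCorners ℝ (EuclideanSpace ℝ (Fin 1) × ℝ) (ModelProd (EuclideanHalfSpace 1) ℝ) :=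
  (𝓡∂ 1).prod 𝓘(ℝ, ℝ)

/-- The one-form `dq` on `T^*D^1`. -/
def baseDifferential : OneForm cotangentDiskModel CotangentDisk :=
  fun z => mfderiv cotangentDiskModel 𝓘(ℝ, ℝ) (fun w : CotangentDisk => (w.1 : ℝ)) z

/-- The canonical one-form `p dq` on `T^*D^1`. -/
def canonicalForm : OneForm cotangentDiskModel CotangentDisk :=
  fun z => z.2 • baseDifferential z

/-- The cotangent fiber `T^*_0 D^1`. -/
def zeroFiber : Set CotangentDisk := {z | (z.1 : ℝ) = 0}

variable {E : Type*} [NormedAddCommGroup E] [NormedSpace ℝ E]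
  {H : Type*} [TopologicalSpace H] (I : ModelWithCorners ℝ E H)
  {X : Type*} [TopologicalSpace X] [ChartedSpace H X]

/-- The product one-form `θ + p dq` on the stabilization `X × T^*D^1`. -/
def OneForm.stabilize (θ : OneForm I X) :
    OneForm (I.prod cotangentDiskModel) (X × CotangentDisk) :=
  fun z =>
    (θ z.1).comp (mfderiv (I.prod cotangentDiskModel) I Prod.fst z) +
      (canonicalForm z.2).comp
        (mfderiv (I.prod cotangentDiskModel) cotangentDiskModel Prod.snd z)

end Stabilization

end

/-! The extra coordinate `q` gives room to separate the components. Keep the second component over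
`q = 0` and move the first over `q = t(1 - t)` while it follows its own isotopy. For `0 < t < 1` the
two lie over different values of `q`, so intersections of their projections to `X` do no harm; at `t
= 0, 1` both lie over `q = 0`, where the given links are disjoint.

Each stage is a product with a fiber `q = c`, along which `p dq` pulls back to zero. Hence the
pullback of `μ + p dq` is that of `μ`, for every one-form `μ`
(`pullback_stabilize_fiberStabilization`); this gives exactness, with the same primitive, and strong
exactness. Isotropy follows because `dp ∧ dq` vanishes on vectors without `q`-component
(`OneForm.d_stabilize_of_base_eq_zero`). Properness survives adding the continuous coordinate `c`
(`IsProperMap.prodMk_of_t2`). -/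

open Filter Topology

/-! ### Proper maps with an added component. -/

section ProperMaps

/-- Adding a continuous component with values in a Hausdorff space keeps a map proper. -/
theorem IsProperMap.prodMk_of_t2 {A Y Z : Type*} [TopologicalSpace A] [TopologicalSpace Y]
    [TopologicalSpace Z] [T2Space Z] {f : A → Y} (hf : IsProperMap f) {c : A → Z}
    (hc : Continuous c) : IsProperMap fun a => (f a, c a) := by
  rw [isProperMap_iff_ultrafilter] at hf ⊢
  refine ⟨hf.1.prodMk hc, fun 𝒰 y hy => ?_⟩
  obtain ⟨x, hx, hle⟩ := hf.2 (continuous_fst.continuousAt.tendsto.comp hy : Tendsto f 𝒰 (𝓝 y.1))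
  -- Continuity sends the ultrafilter to `c x`, and the Hausdorff property identifies this limit
  -- with `y.2`.
  have h₁ : Tendsto c 𝒰 (𝓝 (c x)) := hc.continuousAt.tendsto.mono_left hle
  have h₂ : Tendsto c 𝒰 (𝓝 y.2) := continuous_snd.continuousAt.tendsto.comp hy
  exact ⟨x, Prod.ext hx (tendsto_nhds_unique h₁ h₂), hle⟩

end ProperMaps

/-! ### One-forms in charts and the exterior derivative of `θ + p dq`. -/

section OneForms

variable {E : Type*} [NormedAddCommGroup E] [NormedSpace ℝ E]
  {H : Type*} [TopologicalSpace H] {I : ModelWithCorners ℝ E H}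
  {X : Type*} [TopologicalSpace X] [ChartedSpace H X]

/-- A smooth one-form has a differentiable expression in the preferred charts. -/
theorem OneForm.IsSmooth.differentiableWithinAt_inChart [IsManifold I ∞ X] {θ : OneForm I X}
    (hθ : θ.IsSmooth I) (x : X) :
    DifferentiableWithinAt ℝ (θ.inChart I x) (range I) (extChartAt I x x) := by
  have : IsManifold I 1 X := .of_le (n := ∞) (by simp)
  -- Smoothness of the section is read in the bundle trivializations at `x`; composed with the
  -- inverse chart, that reading agrees with `inChart` on the chart target.
  have h := ((contMDiffAt_hom_bundle _).1 (hθ x)).2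
  have h' := (h.comp_contMDiffWithinAt_of_eq (contMDiffWithinAt_extChartAt_symm_range (n := ∞) x
    (mem_extChartAt_target (I := I) x)) (extChartAt_to_inv x)).contDiffWithinAt
  refine (h'.differentiableWithinAt (by simp)).congr_of_eventuallyEq_of_mem ?_
    (extChartAt_target_subset_range x (mem_extChartAt_target x))
  filter_upwards [extChartAt_target_mem_nhdsWithin (I := I) x] with y hy
  have hs : (extChartAt I x).symm y ∈ (chartAt H x).source := by
    simpa using (extChartAt I x).map_target hy
  ext v
  simp only [OneForm.inChart, Function.comp_apply, ContinuousLinearMap.inCoordinates,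
    TangentBundle.symmL_trivializationAt hs]
  rw [(extChartAt I x).right_inv hy]
  have ht : (trivializationAt ℝ (Bundle.Trivial X ℝ) x).continuousLinearMapAt ℝ
      ((extChartAt I x).symm y) = ContinuousLinearMap.id ℝ ℝ :=
    Bundle.Trivial.continuousLinearMapAt_trivialization ℝ X ℝ _
  exact (DFunLike.congr_fun ht _).symm

section Product

variable {E' : Type*} [NormedAddCommGroup E'] [NormedSpace ℝ E']
  {H' : Type*} [TopologicalSpace H'] {I' : ModelWithCorners ℝ E' H'}
  {Y : Type*} [TopologicalSpace Y] [ChartedSpace H' Y]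
  [IsManifold I 1 X] [IsManifold I' 1 Y]

/-- The inverse of a product chart followed by the projection is the projection followed by the
inverse chart of the factor; both sides are the chain rule for this one map. It serves to split
`inChart` of a stabilized form. -/
theorem mfderiv_fst_comp_mfderivWithin_extChartAt_symm (z : X × Y) {y : E × E'}
    (hy : y ∈ (extChartAt (I.prod I') z).target) :
    (mfderiv (I.prod I') I Prod.fst ((extChartAt (I.prod I') z).symm y)).comp
      (mfderivWithin 𝓘(ℝ, E × E') (I.prod I') (extChartAt (I.prod I') z).symm
        (range (I.prod I')) y) =
      (mfderivWithin 𝓘(ℝ, E) I (extChartAt I z.1).symm (range I) y.1).comp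
        (ContinuousLinearMap.fst ℝ E E') := by
  have hy' := hy
  rw [extChartAt_prod, PartialEquiv.prod_target] at hy'
  have hU : UniqueMDiffWithinAt 𝓘(ℝ, E × E') (range (I.prod I')) y :=
    (I.prod I').uniqueDiffOn.uniqueMDiffOn y (extChartAt_target_subset_range z hy)
  have hm : range (I.prod I') ⊆ Prod.fst ⁻¹' range I := by
    rintro _ ⟨w, rfl⟩
    exact ⟨w.1, rfl⟩
  have hc := mfderivWithin_comp (I := 𝓘(ℝ, E × E')) y
    (mdifferentiableWithinAt_extChartAt_symm (I := I) hy'.1)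
    (differentiableAt_fst (𝕜 := ℝ) (p := y)).mdifferentiableAt.mdifferentiableWithinAt hm hU
  rw [mfderivWithin_eq_fderivWithin, fderivWithin_fst hU.uniqueDiffWithinAt] at hc
  rw [← mfderiv_comp_mfderivWithin y mdifferentiableAt_fst
    (mdifferentiableWithinAt_extChartAt_symm hy) hU]
  exact hc

theorem mfderiv_snd_comp_mfderivWithin_extChartAt_symm (z : X × Y) {y : E × E'}
    (hy : y ∈ (extChartAt (I.prod I') z).target) :
    (mfderiv (I.prod I') I' Prod.snd ((extChartAt (I.prod I') z).symm y)).comp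
      (mfderivWithin 𝓘(ℝ, E × E') (I.prod I') (extChartAt (I.prod I') z).symm
        (range (I.prod I')) y) =
      (mfderivWithin 𝓘(ℝ, E') I' (extChartAt I' z.2).symm (range I') y.2).comp
        (ContinuousLinearMap.snd ℝ E E') := by
  have hy' := hy
  rw [extChartAt_prod, PartialEquiv.prod_target] at hy'
  have hU : UniqueMDiffWithinAt 𝓘(ℝ, E × E') (range (I.prod I')) y :=
    (I.prod I').uniqueDiffOn.uniqueMDiffOn y (extChartAt_target_subset_range z hy)
  have hm : range (I.prod I') ⊆ Prod.snd ⁻¹' range I' := by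
    rintro _ ⟨w, rfl⟩
    exact ⟨w.2, rfl⟩
  have hc := mfderivWithin_comp (I := 𝓘(ℝ, E × E')) y
    (mdifferentiableWithinAt_extChartAt_symm (I := I') hy'.2)
    (differentiableAt_snd (𝕜 := ℝ) (p := y)).mdifferentiableAt.mdifferentiableWithinAt hm hU
  rw [mfderivWithin_eq_fderivWithin, fderivWithin_snd hU.uniqueDiffWithinAt] at hc
  rw [← mfderiv_comp_mfderivWithin y mdifferentiableAt_snd
    (mdifferentiableWithinAt_extChartAt_symm hy) hU]
  exact hc

end Product

/-- In product charts, `θ + p dq` is the sum of the expressions of its two summands. -/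
theorem OneForm.inChart_stabilize [IsManifold I 1 X] (θ : OneForm I X) (z : X × CotangentDisk)
    {y : E × (EuclideanSpace ℝ (Fin 1) × ℝ)}
    (hy : y ∈ (extChartAt (I.prod cotangentDiskModel) z).target) :
    (θ.stabilize I).inChart (I.prod cotangentDiskModel) z y =
      (θ.inChart I z.1 y.1).comp (ContinuousLinearMap.fst ℝ _ _) +
        (OneForm.inChart cotangentDiskModel canonicalForm z.2 y.2).comp
          (ContinuousLinearMap.snd ℝ _ _) := by
  refine ContinuousLinearMap.ext fun v => ?_
  have h₁ := congrArg (θ ((extChartAt I z.1).symm y.1))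
    (DFunLike.congr_fun (mfderiv_fst_comp_mfderivWithin_extChartAt_symm z hy) v)
  have h₂ := congrArg (canonicalForm ((extChartAt cotangentDiskModel z.2).symm y.2))
    (DFunLike.congr_fun (mfderiv_snd_comp_mfderivWithin_extChartAt_symm z hy) v)
  exact congrArg₂ (· + ·) h₁ h₂

/-- Away from `q = 1`, the preferred charts of `T^*D^1` are `(q, p) ↦ (q + 1, p)`, so that `p dq`
has its standard expression. -/
theorem canonicalForm_inChart_eventuallyEq (w : CotangentDisk) (hw : (w.1 : ℝ) < 1) :
    OneForm.inChart cotangentDiskModel canonicalForm w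
      =ᶠ[𝓝[range cotangentDiskModel] (extChartAt cotangentDiskModel w w)]
    fun y => y.2 • ((EuclideanSpace.proj (0 : Fin 1) : EuclideanSpace ℝ (Fin 1) →L[ℝ] ℝ).comp
      (ContinuousLinearMap.fst ℝ (EuclideanSpace ℝ (Fin 1)) ℝ)) := by
  have hq : ∀ y ∈ (extChartAt cotangentDiskModel w).target,
      (((extChartAt cotangentDiskModel w).symm y).1 : ℝ) = y.1 0 - 1 := by
    intro y hy
    rw [extChartAt_prod, PartialEquiv.prod_target] at hy
    have hy₁ := hy.1
    rw [extChartAt, Icc_chartedSpaceChartAt_of_le_top hw] at hy₁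
    obtain ⟨h, hh⟩ : y.1 ∈ range (𝓡∂ 1) := extChartAt_target_subset_range w.1 hy.1
    have hsymm : (𝓡∂ 1).symm y.1 = h := by rw [← hh, (𝓡∂ 1).left_inv]
    have hval : y.1 0 = h.val 0 := by rw [← hh]; rfl
    rw [extChartAt_prod, PartialEquiv.prod_coe_symm, extChartAt,
      Icc_chartedSpaceChartAt_of_le_top hw]
    simp only [IccLeftChart, OpenPartialHomeomorph.extend, PartialEquiv.trans_target,
      mem_inter_iff, mem_preimage, ModelWithCorners.toPartialEquiv_coe_symm, hsymm,
      mem_ofPred_eq] at hy₁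
    -- The inverse of the left chart truncates at `1`; on the chart target the truncation is
    -- inactive.
    have hle : h.val 0 + -1 ≤ 1 := by linarith [hy₁.2]
    change min (((𝓡∂ 1).symm y.1).val 0 + -1) 1 = y.1 0 - 1
    rw [hsymm, hval, min_eq_left hle, sub_eq_add_neg]
  filter_upwards [extChartAt_target_mem_nhdsWithin (I := cotangentDiskModel) w] with y hy
  have hU : UniqueMDiffWithinAt 𝓘(ℝ, EuclideanSpace ℝ (Fin 1) × ℝ) (range cotangentDiskModel) y :=
    cotangentDiskModel.uniqueDiffOn.uniqueMDiffOn y (extChartAt_target_subset_range w hy)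
  have hsm : MDifferentiableAt cotangentDiskModel 𝓘(ℝ, ℝ) (fun w : CotangentDisk => (w.1 : ℝ))
      ((extChartAt cotangentDiskModel w).symm y) :=
    ((contMDiff_subtypeVal_Icc (n := 1)).comp contMDiff_fst).mdifferentiableAt (by simp)
  have hc := mfderiv_comp_mfderivWithin y hsm
    (mdifferentiableWithinAt_extChartAt_symm hy) hU
  have hd : mfderivWithin 𝓘(ℝ, EuclideanSpace ℝ (Fin 1) × ℝ) 𝓘(ℝ, ℝ)
      ((fun w : CotangentDisk => (w.1 : ℝ)) ∘ (extChartAt cotangentDiskModel w).symm)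
      (range cotangentDiskModel) y =
      (EuclideanSpace.proj (0 : Fin 1) : EuclideanSpace ℝ (Fin 1) →L[ℝ] ℝ).comp
      (ContinuousLinearMap.fst ℝ (EuclideanSpace ℝ (Fin 1)) ℝ) := by
    rw [mfderivWithin_eq_fderivWithin]
    have : HasFDerivWithinAt (fun y : EuclideanSpace ℝ (Fin 1) × ℝ => y.1 0 - 1)
      ((EuclideanSpace.proj (0 : Fin 1) : EuclideanSpace ℝ (Fin 1) →L[ℝ] ℝ).comp
      (ContinuousLinearMap.fst ℝ (EuclideanSpace ℝ (Fin 1)) ℝ)) (range cotangentDiskModel) y :=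
      HasFDerivWithinAt.sub_const (1 : ℝ) (ContinuousLinearMap.hasFDerivWithinAt
        ((EuclideanSpace.proj (0 : Fin 1) : EuclideanSpace ℝ (Fin 1) →L[ℝ] ℝ).comp
          (ContinuousLinearMap.fst ℝ (EuclideanSpace ℝ (Fin 1)) ℝ)))
    refine (this.congr_of_eventuallyEq ?_ (hq y hy)).fderivWithin hU.uniqueDiffWithinAt
    filter_upwards [extChartAt_target_mem_nhdsWithin_of_mem hy] with y' hy' using hq y' hy'
  rw [hd] at hc
  refine ContinuousLinearMap.ext fun v => ?_
  exact congrArg (y.2 * ·) (DFunLike.congr_fun hc v).symm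

/-- On vectors with vanishing `q`-component, `d (θ + p dq)` is `dθ`. -/
theorem OneForm.d_stabilize_of_base_eq_zero [IsManifold I ∞ X] {θ : OneForm I X}
    (hθ : θ.IsSmooth I) (z : X × CotangentDisk) (hz : (z.2.1 : ℝ) < 1) (u v : E) (a b : ℝ) :
    (θ.stabilize I).d (I.prod cotangentDiskModel) z
      ((u, (0, a)) : E × (EuclideanSpace ℝ (Fin 1) × ℝ))
      ((v, (0, b)) : E × (EuclideanSpace ℝ (Fin 1) × ℝ)) = θ.d I z.1 u v := by
  have : IsManifold I 1 X := .of_le (n := ∞) (by simp)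
  set P : (EuclideanSpace ℝ (Fin 1) × ℝ) →L[ℝ] ℝ :=
    (EuclideanSpace.proj (0 : Fin 1) : EuclideanSpace ℝ (Fin 1) →L[ℝ] ℝ).comp
      (ContinuousLinearMap.fst ℝ (EuclideanSpace ℝ (Fin 1)) ℝ) with hP
  set S := range (I.prod cotangentDiskModel)
  set y₀ := extChartAt (I.prod cotangentDiskModel) z z
  have hy₀ : y₀ ∈ S := extChartAt_target_subset_range z (mem_extChartAt_target z)
  have hS₁ : MapsTo Prod.fst S (range I) := by
    rintro _ ⟨w, rfl⟩
    exact ⟨w.1, rfl⟩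
  have hS₂ : MapsTo Prod.snd S (range cotangentDiskModel) := by
    rintro _ ⟨w, rfl⟩
    exact ⟨w.2, rfl⟩
  -- Only the germ at `y₀` matters for the derivative, so the standard expression of `p dq` may be
  -- substituted.
  have hev : (θ.stabilize I).inChart (I.prod cotangentDiskModel) z =ᶠ[𝓝[S] y₀]
      fun y => (θ.inChart I z.1 y.1).comp (ContinuousLinearMap.fst ℝ _ _) +
        (y.2.2 • P).comp (ContinuousLinearMap.snd ℝ _ _) := by
    have ht : Tendsto Prod.snd (𝓝[S] y₀)
        (𝓝[range cotangentDiskModel] (extChartAt cotangentDiskModel z.2 z.2)) :=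
      continuous_snd.continuousWithinAt.tendsto_nhdsWithin hS₂
    filter_upwards [extChartAt_target_mem_nhdsWithin (I := I.prod cotangentDiskModel) z,
      ht.eventually (canonicalForm_inChart_eventuallyEq z.2 hz)] with y hy hy'
    rw [OneForm.inChart_stabilize θ z hy, hy']
  have hd₁ : HasFDerivWithinAt (fun y : E × (EuclideanSpace ℝ (Fin 1) × ℝ) => θ.inChart I z.1 y.1)
      ((fderivWithin ℝ (θ.inChart I z.1) (range I) (extChartAt I z.1 z.1)).comp
        (ContinuousLinearMap.fst ℝ _ _)) S y₀ :=
    HasFDerivWithinAt.comp (g := θ.inChart I z.1) (f := Prod.fst) y₀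
      (hθ.differentiableWithinAt_inChart z.1).hasFDerivWithinAt hasFDerivWithinAt_fst hS₁
  have hd₂ : HasFDerivWithinAt (fun y : E × (EuclideanSpace ℝ (Fin 1) × ℝ) => y.2.2 • P)
      (((ContinuousLinearMap.snd ℝ _ _).comp (ContinuousLinearMap.snd ℝ _ _)).smulRight P) S y₀ :=
    ContinuousLinearMap.hasFDerivWithinAt
      (((ContinuousLinearMap.snd ℝ (EuclideanSpace ℝ (Fin 1)) ℝ).comp
        (ContinuousLinearMap.snd ℝ E _)).smulRight P)
  have hd := ((hd₁.clm_comp (hasFDerivWithinAt_const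
    (ContinuousLinearMap.fst ℝ E (EuclideanSpace ℝ (Fin 1) × ℝ)) y₀ S)).add (hd₂.clm_comp
      (hasFDerivWithinAt_const (ContinuousLinearMap.snd ℝ E (EuclideanSpace ℝ (Fin 1) × ℝ))
        y₀ S))).congr_of_eventuallyEq hev (hev.self_of_nhdsWithin hy₀)
  have hU := (I.prod cotangentDiskModel).uniqueDiffOn y₀ hy₀
  unfold OneForm.d
  rw [hd.fderivWithin hU]
  -- The second summand contributes `dp ∧ dq`, each term of which contains `P` applied to a vector
  -- with zero `q`-component.
  simp [hP]

end OneForms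

/-! ### Products with cotangent fibers as exact Lagrangians. -/

section Stabilization

section Sets

variable {X M : Type*}

/-- The product of `f : M → X` with the parametrized cotangent fiber `p ↦ (c, p)` of `T^*D^1`. -/
def fiberStabilization (f : M → X) (c : Icc (-1 : ℝ) 1) (z : M × ℝ) : X × CotangentDisk :=
  (f z.1, (c, z.2))

theorem range_fiberStabilization (f : M → X) {c : Icc (-1 : ℝ) 1} (hc : (c : ℝ) = 0) :
    range (fiberStabilization f c) = range f ×ˢ zeroFiber := by
  ext ⟨x, q, p⟩
  constructor
  · rintro ⟨⟨m, s⟩, h⟩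
    simp only [fiberStabilization, Prod.mk.injEq] at h
    exact ⟨⟨m, h.1⟩, by rw [← h.2.1]; exact hc⟩
  · rintro ⟨⟨m, hm⟩, hq⟩
    exact ⟨(m, p), Prod.ext hm (Prod.ext (Subtype.ext (hc.trans hq.symm)) rfl)⟩

/-- A common point has a common `q`-coordinate, so disjointness in `X` is needed only when the two
fibers coincide. -/
theorem disjoint_range_fiberStabilization {N : Type*} {f : M → X} {g : N → X}
    {c c' : Icc (-1 : ℝ) 1} (h : c = c' → Disjoint (range f) (range g)) :
    Disjoint (range (fiberStabilization f c)) (range (fiberStabilization g c')) := by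
  rw [disjoint_left]
  rintro _ ⟨z, rfl⟩ ⟨z', hz⟩
  simp only [fiberStabilization, Prod.mk.injEq] at hz
  exact disjoint_left.1 (h hz.2.1.symm) ⟨z.1, rfl⟩ ⟨z'.1, hz.1⟩

end Sets

variable {E : Type*} [NormedAddCommGroup E] [NormedSpace ℝ E]
  {H : Type*} [TopologicalSpace H] {I : ModelWithCorners ℝ E H}
  {X : Type*} [TopologicalSpace X] [ChartedSpace H X]
  {F : Type*} [NormedAddCommGroup F] [NormedSpace ℝ F]
  {G : Type*} [TopologicalSpace G] {J : ModelWithCorners ℝ F G}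
  {M : Type*} [TopologicalSpace M] [ChartedSpace G M]

/-- The middle component of the differential is `0` because `q` is constant; the isotropy and
pullback computations both rest on this zero. -/
theorem mfderiv_fiberStabilization {f : M → X} (hf : MDifferentiable J I f) (c : Icc (-1 : ℝ) 1)
    (z : M × ℝ) (u : F) (a : ℝ) :
    mfderiv (J.prod 𝓘(ℝ, ℝ)) (I.prod cotangentDiskModel) (fiberStabilization f c) z
      ((u, a) : F × ℝ) =
      ((mfderiv J I f z.1 u, (0, a)) : E × (EuclideanSpace ℝ (Fin 1) × ℝ)) := by
  have h₁ : MDifferentiableAt (J.prod 𝓘(ℝ, ℝ)) I (fun z : M × ℝ => f z.1) z :=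
    (hf z.1).comp z mdifferentiableAt_fst
  have h₂ : MDifferentiableAt (J.prod 𝓘(ℝ, ℝ)) (𝓡∂ 1) (fun _ : M × ℝ => c) z :=
    mdifferentiableAt_const
  have h₃ : MDifferentiableAt (J.prod 𝓘(ℝ, ℝ)) 𝓘(ℝ, ℝ) (fun z : M × ℝ => z.2) z :=
    mdifferentiableAt_snd
  have e₁ : mfderiv (J.prod 𝓘(ℝ, ℝ)) I (fun z : M × ℝ => f z.1) z ((u, a) : F × ℝ) =
      mfderiv J I f z.1 u := by
    have := mfderiv_comp z (hf z.1) (mdifferentiableAt_fst (I' := 𝓘(ℝ, ℝ)))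
    rw [mfderiv_fst] at this
    exact DFunLike.congr_fun this ((u, a) : F × ℝ)
  have e₂ := mfderiv_prodMk h₂ h₃
  rw [mfderiv_const, mfderiv_snd] at e₂
  have e := DFunLike.congr_fun (mfderiv_prodMk h₁ (h₂.prodMk h₃)) ((u, a) : F × ℝ)
  refine Eq.trans e (Prod.ext e₁ ?_)
  exact DFunLike.congr_fun e₂ ((u, a) : F × ℝ)

/-- The one-form `p dq` vanishes along cotangent fibers. -/
theorem pullback_stabilize_fiberStabilization (μ : OneForm I X) {f : M → X}
    (hf : MDifferentiable J I f) (c : Icc (-1 : ℝ) 1) (z : M × ℝ) (u : F) (a : ℝ) :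
    (μ.stabilize I).pullback (I.prod cotangentDiskModel) (J.prod 𝓘(ℝ, ℝ))
      (fiberStabilization f c) z ((u, a) : F × ℝ) = μ.pullback I J f z.1 u := by
  have hq : baseDifferential (c, z.2) ((0, a) : EuclideanSpace ℝ (Fin 1) × ℝ) = 0 := by
    have := mfderiv_comp (I := cotangentDiskModel) ((c, z.2) : CotangentDisk)
      ((contMDiff_subtypeVal_Icc (n := 1) c).mdifferentiableAt (by simp))
      mdifferentiableAt_fst
    rw [mfderiv_fst] at this
    refine (DFunLike.congr_fun this ((0, a) : EuclideanSpace ℝ (Fin 1) × ℝ)).trans ?_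
    exact map_zero (mfderiv (𝓡∂ 1) 𝓘(ℝ, ℝ) (Subtype.val : Icc (-1 : ℝ) 1 → ℝ) c)
  have hd := mfderiv_fiberStabilization hf c z u a
  have h : (μ.stabilize I).pullback (I.prod cotangentDiskModel) (J.prod 𝓘(ℝ, ℝ))
      (fiberStabilization f c) z ((u, a) : F × ℝ) =
      (μ.stabilize I) (fiberStabilization f c z)
        ((mfderiv J I f z.1 u, (0, a)) : E × (EuclideanSpace ℝ (Fin 1) × ℝ)) :=
    congrArg ((μ.stabilize I) (fiberStabilization f c z)) hd
  rw [h]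
  simp only [OneForm.stabilize, mfderiv_fst, mfderiv_snd]
  have hc : canonicalForm (c, z.2) ((0, a) : EuclideanSpace ℝ (Fin 1) × ℝ) = 0 := by
    refine Eq.trans (congrArg (z.2 * ·) hq) (mul_zero _)
  exact (congrArg (μ (f z.1) (mfderiv J I f z.1 u) + ·) hc).trans (add_zero _)

/-- The fiber must lie over an interior point of `[-1, 1]`: this keeps the image off the boundary,
and `c < 1` selects the chart in which `p dq` is standard. -/
theorem isExactLagrangianEmbedding_fiberStabilization [FiniteDimensional ℝ E]
    [FiniteDimensional ℝ F] [IsManifold I ∞ X] {θ : OneForm I X} (hθ : θ.IsSmooth I) {f : M → X}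
    (hf : IsExactLagrangianEmbedding I J θ f) {c : Icc (-1 : ℝ) 1}
    (hc : (c : ℝ) ∈ Ioo (-1 : ℝ) 1) :
    IsExactLagrangianEmbedding (I.prod cotangentDiskModel) (J.prod 𝓘(ℝ, ℝ)) (θ.stabilize I)
      (fiberStabilization f c) where
  smooth := (hf.smooth.comp contMDiff_fst).prodMk (contMDiff_const.prodMk contMDiff_snd)
  injective := by
    rintro ⟨m, s⟩ ⟨m', s'⟩ h
    simp only [fiberStabilization, Prod.mk.injEq] at h
    exact Prod.ext (hf.injective h.1) h.2.2
  injective_mfderiv := by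
    rintro z ⟨u, a⟩ ⟨v, b⟩ h
    have hm := hf.smooth.mdifferentiable (by simp)
    have h' : ((mfderiv J I f z.1 u, (0, a)) : E × (EuclideanSpace ℝ (Fin 1) × ℝ)) =
        (mfderiv J I f z.1 v, (0, b)) := (mfderiv_fiberStabilization hm c z u a).symm.trans
      (h.trans (mfderiv_fiberStabilization hm c z v b))
    exact Prod.ext (hf.injective_mfderiv z.1 (congrArg Prod.fst h'))
      (congrArg (fun w => w.2.2) h')
  proper := by
    have h := (hf.proper.prodMap (isProperMap_id (X := ℝ))).prodMk_of_t2
      (continuous_const (y := c))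
    -- The constant coordinate was appended last; this homeomorphism moves it in front of `p`.
    let e : (X × ℝ) × Icc (-1 : ℝ) 1 ≃ₜ X × CotangentDisk :=
      (Homeomorph.prodAssoc X ℝ _).trans
        ((Homeomorph.refl X).prodCongr (Homeomorph.prodComm ℝ _))
    exact e.isProperMap.comp h
  interior m := by
    rw [ModelWithCorners.interior_prod, ModelWithCorners.interior_prod]
    refine ⟨hf.interior m.1, Icc_isInteriorPoint_interior hc, ?_⟩
    rw [ModelWithCorners.interior_eq_univ]
    trivial
  half_dim := by
    have := hf.half_dim
    simp only [Module.finrank_prod, finrank_euclideanSpace, Fintype.card_fin, Module.finrank_self]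
    omega
  isotropic := by
    rintro z ⟨u, a⟩ ⟨v, b⟩
    have hm := hf.smooth.mdifferentiable (by simp)
    have h₁ := mfderiv_fiberStabilization hm c z u a
    have h₂ := mfderiv_fiberStabilization hm c z v b
    refine (congrArg₂ ((θ.stabilize I).d (I.prod cotangentDiskModel) (fiberStabilization f c z))
      h₁ h₂).trans ?_
    exact (OneForm.d_stabilize_of_base_eq_zero hθ (fiberStabilization f c z) hc.2 _ _ a b).trans
      (hf.isotropic z.1 u v)
  exact := by
    obtain ⟨g, hg, h⟩ := hf.exact
    -- A primitive on `M`, made constant along the fiber, is still a primitive.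
    refine ⟨fun z => g z.1, hg.comp contMDiff_fst, ?_⟩
    rintro z ⟨u, a⟩
    have hd := mfderiv_comp z ((hg z.1).mdifferentiableAt (by simp))
      (mdifferentiableAt_fst (I := J) (I' := 𝓘(ℝ, ℝ)))
    rw [mfderiv_fst] at hd
    exact (pullback_stabilize_fiberStabilization θ (hf.smooth.mdifferentiable (by simp)) c z u
      a).trans ((h z.1 u).trans (DFunLike.congr_fun hd ((u, a) : F × ℝ)).symm)

theorem isExactLagrangianIsotopy_fiberStabilization [FiniteDimensional ℝ E]
    [FiniteDimensional ℝ F] [IsManifold I ∞ X] {θ : OneForm I X} (hθ : θ.IsSmooth I)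
    {φ : ℝ → M → X} (hφ : IsExactLagrangianIsotopy I J θ φ) {c : ℝ → Icc (-1 : ℝ) 1}
    (hc : ContMDiffOn 𝓘(ℝ, ℝ) (𝓡∂ 1) ∞ c (Icc 0 1))
    (hcI : ∀ t ∈ Icc (0 : ℝ) 1, (c t : ℝ) ∈ Ioo (-1 : ℝ) 1) :
    IsExactLagrangianIsotopy (I.prod cotangentDiskModel) (J.prod 𝓘(ℝ, ℝ)) (θ.stabilize I)
      (fun t => fiberStabilization (φ t) (c t)) where
  smooth := by
    have h₁ : ContMDiffOn (𝓘(ℝ, ℝ).prod (J.prod 𝓘(ℝ, ℝ))) I ∞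
        (fun p : ℝ × (M × ℝ) => φ p.1 p.2.1) (Icc (0 : ℝ) 1 ×ˢ univ) :=
      hφ.smooth.comp (contMDiff_fst.prodMk (contMDiff_fst.comp contMDiff_snd)).contMDiffOn
        fun p hp => ⟨hp.1, trivial⟩
    have h₂ : ContMDiffOn (𝓘(ℝ, ℝ).prod (J.prod 𝓘(ℝ, ℝ))) (𝓡∂ 1) ∞
        (fun p : ℝ × (M × ℝ) => c p.1) (Icc (0 : ℝ) 1 ×ˢ univ) :=
      hc.comp contMDiff_fst.contMDiffOn fun p hp => hp.1
    exact h₁.prodMk (h₂.prodMk (contMDiff_snd.comp contMDiff_snd).contMDiffOn)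
  proper := by
    have hcc : Continuous fun p : (Icc (0 : ℝ) 1 × M) × ℝ => c p.1.1 :=
      hc.continuousOn.domRestrict.comp (continuous_fst.comp continuous_fst)
    have h := (hφ.proper.prodMap (isProperMap_id (X := ℝ))).prodMk_of_t2 hcc
    let e : (X × ℝ) × Icc (-1 : ℝ) 1 ≃ₜ X × CotangentDisk :=
      (Homeomorph.prodAssoc X ℝ _).trans
        ((Homeomorph.refl X).prodCongr (Homeomorph.prodComm ℝ _))
    exact e.isProperMap.comp (h.comp (Homeomorph.prodAssoc _ M ℝ).symm.isProperMap)
  embedding t ht := isExactLagrangianEmbedding_fiberStabilization hθ (hφ.embedding t ht)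
    (hcI t ht)

end Stabilization

/-! ### The link isotopy. -/

theorem mainTheorem9 {n : ℕ}
    {E : Type*} [NormedAddCommGroup E] [NormedSpace ℝ E] [FiniteDimensional ℝ E]
    (hE : Module.finrank ℝ E = 2 * n)
    {H : Type*} [TopologicalSpace H] (I : ModelWithCorners ℝ E H)
    {X : Type*} [TopologicalSpace X] [ChartedSpace H X] [IsManifold I ∞ X]
    (θ : OneForm I X) (hθ : IsExactSymplectic I θ)
    {M : Type*} [TopologicalSpace M] [ChartedSpace (EuclideanSpace ℝ (Fin n)) M]
    [IsManifold (𝓡 n) ∞ M]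
    {N : Type*} [TopologicalSpace N] [ChartedSpace (EuclideanSpace ℝ (Fin n)) N]
    [IsManifold (𝓡 n) ∞ N]
    (L L' K K' : Set X) (hLK : Disjoint L K) (hLK' : Disjoint L' K')
    (φ : ℝ → M → X) (hφ : IsExactLagrangianIsotopy I (𝓡 n) θ φ)
    (hφ₀ : range (φ 0) = L) (hφ₁ : range (φ 1) = L')
    (ψ : ℝ → N → X) (hψ : IsExactLagrangianIsotopy I (𝓡 n) θ ψ)
    (hψ₀ : range (ψ 0) = K) (hψ₁ : range (ψ 1) = K') :
    ∃ (Φ : ℝ → M × ℝ → X × CotangentDisk) (Ψ : ℝ → N × ℝ → X × CotangentDisk),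
      IsExactLagrangianLinkIsotopy (I.prod cotangentDiskModel) ((𝓡 n).prod 𝓘(ℝ, ℝ))
        (θ.stabilize I) Φ Ψ ∧
      range (Φ 0) = L ×ˢ zeroFiber ∧ range (Φ 1) = L' ×ˢ zeroFiber ∧
      range (Ψ 0) = K ×ˢ zeroFiber ∧ range (Ψ 1) = K' ×ˢ zeroFiber ∧
      -- components on which a one-form `μ` vanishes move through components on which
      -- the product one-form `μ + p dq` vanishes
      (∀ (μ : OneForm I X), ∀ t ∈ Icc (0 : ℝ) 1,
        ((∀ m, μ.pullback I (𝓡 n) (φ t) m = 0) →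
          ∀ z, (μ.stabilize I).pullback (I.prod cotangentDiskModel)
            ((𝓡 n).prod 𝓘(ℝ, ℝ)) (Φ t) z = 0) ∧
        ((∀ m, μ.pullback I (𝓡 n) (ψ t) m = 0) →
          ∀ z, (μ.stabilize I).pullback (I.prod cotangentDiskModel)
            ((𝓡 n).prod 𝓘(ℝ, ℝ)) (Ψ t) z = 0)) := by
  -- `t(1 - t)` vanishes only at `t = 0, 1` and stays in `(-1, 1)` on `[0, 1]`. The projection
  -- merely makes `c` total: it changes nothing for times in `[0, 1]`.
  let c : ℝ → Icc (-1 : ℝ) 1 := fun t => projIcc (-1) 1 (by norm_num) (t * (1 - t))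
  have hmem : ∀ t ∈ Icc (0 : ℝ) 1, t * (1 - t) ∈ Ioo (-1 : ℝ) 1 := fun t ht =>
    ⟨by nlinarith [ht.1, ht.2], by nlinarith [ht.1, ht.2]⟩
  have hval : ∀ t ∈ Icc (0 : ℝ) 1, (c t : ℝ) = t * (1 - t) := fun t ht =>
    congrArg Subtype.val (projIcc_of_mem (by norm_num) (Ioo_subset_Icc_self (hmem t ht)))
  have hc : ContMDiffOn 𝓘(ℝ, ℝ) (𝓡∂ 1) ∞ c (Icc 0 1) :=
    contMDiffOn_projIcc.comp (ContDiff.contMDiff (by fun_prop)).contMDiffOn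
      fun t ht => Ioo_subset_Icc_self (hmem t ht)
  let o : Icc (-1 : ℝ) 1 := ⟨0, by norm_num⟩
  have hc₀ : (c 0 : ℝ) = 0 := by rw [hval 0 (by simp)]; simp
  have hc₁ : (c 1 : ℝ) = 0 := by rw [hval 1 (by simp)]; simp
  refine ⟨fun t => fiberStabilization (φ t) (c t), fun t => fiberStabilization (ψ t) o,
    ⟨isExactLagrangianIsotopy_fiberStabilization hθ.smooth hφ hc
        fun t ht => by rw [hval t ht]; exact hmem t ht,
      isExactLagrangianIsotopy_fiberStabilization hθ.smooth hψ contMDiffOn_const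
        fun t ht => by norm_num [o],
      fun t ht => disjoint_range_fiberStabilization fun h => ?_⟩,
    by rw [range_fiberStabilization _ hc₀, hφ₀], by rw [range_fiberStabilization _ hc₁, hφ₁],
    by rw [range_fiberStabilization _ rfl, hψ₀], by rw [range_fiberStabilization _ rfl, hψ₁],
    fun μ t ht => ⟨fun h z => ?_, fun h z => ?_⟩⟩
  -- Equal fibers force `t(1 - t) = 0`, so only the two end links need to be disjoint in `X`.
  · have h0 : t * (1 - t) = 0 := by rw [← hval t ht, h]
    rcases mul_eq_zero.1 h0 with h0 | h0
    · rwa [h0, hφ₀, hψ₀]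
    · rwa [show t = 1 by linarith, hφ₁, hψ₁]
  · refine ContinuousLinearMap.ext fun v => ?_
    exact (pullback_stabilize_fiberStabilization μ
      ((hφ.embedding t ht).smooth.mdifferentiable (by simp)) (c t) z v.1 v.2).trans
        (DFunLike.congr_fun (h z.1) v.1)
  · refine ContinuousLinearMap.ext fun v => ?_
    exact (pullback_stabilize_fiberStabilization μ
      ((hψ.embedding t ht).smooth.mdifferentiable (by simp)) o z v.1 v.2).trans
        (DFunLike.congr_fun (h z.1) v.1)
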